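/- All posets are finite and graded, with a unique minimal element $\hat 0$, a unique maximal element $\hat 1$, and rank function $\rho$ ($\rho(\hat 0)=0$, and $\rho$ increases by one along each covering relation); the rank of the poset is $\rho(\hat 1)$. An $n$-interval is an interval $[x,y]$ with $\rho(y)-\rho(x)=n$. Such a poset $P$ is a Sheffer poset, with binomial factorial function $B$ and Sheffer factorial function $D$, if every $n$-interval $[\hat 0,y]$ has exactly $D(n)$ maximal chains and every $n$-interval $[x,y]$ with $x\neq\hat 0$ has exactly $B(n)$ maximal chains. It is Eulerian if every non-singleton interval has as many elements of even rank as elements of odd rank. Lemma. Let $P$ be an Eulerian Sheffer poset of rank $n\ge 6$ with binomial factorial function $B$ and Sheffer factorial function $D$. If $B(3)=3!=6$, then $D(3)\in\{4,6,8\}$. -/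

import Mathlib

/-- `[x, y]` is an `n`-interval of a graded poset: `x ≤ y` and `ρ(y) = ρ(x) + n`, where the
rank function `ρ = grade ℕ` increases by one along covering relations and is `0` at the minimum. -/
def IsNInterval {P : Type*} [PartialOrder P] [OrderBot P] [GradeMinOrder ℕ P]
    (n : ℕ) (x y : P) : Prop :=
  x ≤ y ∧ grade ℕ y = grade ℕ x + n

/-- The number of maximal chains of the interval `[x, y]`. -/
noncomputable def numMaxChains {P : Type*} [PartialOrder P] (x y : P) : ℕ :=
  Nat.card (Flag (Set.Icc x y))

/-- The finite graded poset `P` with `0̂` and `1̂` is a Sheffer poset with binomial factorial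
function `B` and Sheffer factorial function `D`. (Only the values of `B` and `D` at those `n`
for which `P` has an `n`-interval of the relevant kind are constrained.) -/
structure IsShefferPoset (P : Type*) [PartialOrder P] [BoundedOrder P] [Finite P]
    [GradeMinOrder ℕ P] (B D : ℕ → ℕ) : Prop where
  /-- Every `n`-interval `[0̂, y]` has `D n` maximal chains. -/
  sheffer : ∀ (n : ℕ) (y : P), IsNInterval n ⊥ y → numMaxChains ⊥ y = D n
  /-- Every `n`-interval `[x, y]` with `x ≠ 0̂` has `B n` maximal chains. -/
  binomial : ∀ (n : ℕ) (x y : P), x ≠ ⊥ → IsNInterval n x y → numMaxChains x y = B n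

/-- A finite graded poset is Eulerian if every non-singleton interval has as many elements of
even rank as elements of odd rank. -/
def IsEulerianPoset (P : Type*) [PartialOrder P] [BoundedOrder P] [Finite P]
    [GradeMinOrder ℕ P] : Prop :=
  ∀ x y : P, x < y →
    {z ∈ Set.Icc x y | Even (grade ℕ z)}.ncard = {z ∈ Set.Icc x y | Odd (grade ℕ z)}.ncard

/-!
Counting maximal chains through the elements of one rank expresses the rank sizes of every interval
in terms of `B` and `D`. The Euler relation of a `4`-interval above an element other than `0̂` then
gives `B 4 = 4!`, and that of a `4`-interval from `0̂` leaves `D 3 ∈ {4, 6, 8}` or, as for the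
dodecahedron, `D 3 = 10` and `D 4 = 120`.

In the latter case the Euler relation of a `6`-interval from `0̂` forces the `5`-intervals above its
atoms to have `6` or `7` atoms themselves. But in such a `5`-interval each atom lies below `4`
coatoms, and there are as many coatoms as atoms; if there are fewer than `8`, any two atoms lie
below a common coatom and hence below a common element of rank `2`. As an atom lies below only `4`
elements of rank `2`, each of which covers one further atom, there are at most `5` atoms.
-/

section MaximalChains

variable {P : Type*} [PartialOrder P] {x y z : P} {s t : Set P}

/-- `s` is a maximal chain of `[x, y]`, viewed as a set of elements of the ambient poset so that
chains of different intervals can be cut and glued. A maximal chain is encoded as a set consisting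
of exactly those elements of `[x, y]` that are comparable to all of its elements. -/
def IsMaxChainIcc (x y : P) (s : Set P) : Prop :=
  ∀ a, a ∈ s ↔ a ∈ Set.Icc x y ∧ ∀ b ∈ s, a ≤ b ∨ b ≤ a

theorem isMaxChainIcc_iff_mem_range : IsMaxChainIcc x y s ↔
    s ∈ Set.range fun F : Flag (Set.Icc x y) => Subtype.val '' (F : Set (Set.Icc x y)) := by
  constructor
  · intro hs
    refine ⟨⟨Subtype.val ⁻¹' s, fun a ha b hb _ => ((hs a).1 ha).2 b hb, fun t ht hst =>
      hst.antisymm fun a ha => (hs a).2 ⟨a.2, fun b hb => ?_⟩⟩,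
      Subtype.image_preimage_coe _ _ |>.trans (Set.inter_eq_right.2 fun a ha => ((hs a).1 ha).1)⟩
    exact ht.total ha (hst (show (⟨b, ((hs b).1 hb).1⟩ : Set.Icc x y) ∈ _ from hb))
  · rintro ⟨F, rfl⟩ a
    constructor
    · rintro ⟨c, hc, rfl⟩
      exact ⟨c.2, by rintro _ ⟨d, hd, rfl⟩; exact F.le_or_le hc hd⟩
    · rintro ⟨ha, hcomp⟩
      exact ⟨⟨a, ha⟩, Flag.mem_iff_forall_le_or_ge.2 fun d hd => hcomp d ⟨d, hd, rfl⟩, rfl⟩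

theorem numMaxChains_eq_ncard (x y : P) :
    numMaxChains x y = {s | IsMaxChainIcc x y s}.ncard := by
  simp only [isMaxChainIcc_iff_mem_range, Set.ofPred_mem_eq]
  exact (Set.ncard_range_of_injective
    (Subtype.val_injective.image_injective.comp SetLike.coe_injective)).symm

theorem exists_isMaxChainIcc (x y : P) : ∃ s, IsMaxChainIcc x y s :=
  ⟨_, isMaxChainIcc_iff_mem_range.2 (Set.mem_range_self (Classical.arbitrary _))⟩

namespace IsMaxChainIcc

theorem mem_of_forall (hs : IsMaxChainIcc x y s) (hz : z ∈ Set.Icc x y)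
    (hcomp : ∀ b ∈ s, z ≤ b ∨ b ≤ z) : z ∈ s :=
  (hs z).2 ⟨hz, hcomp⟩

theorem subset_Icc (hs : IsMaxChainIcc x y s) : s ⊆ Set.Icc x y :=
  fun a ha => ((hs a).1 ha).1

theorem isChain (hs : IsMaxChainIcc x y s) : IsChain (· ≤ ·) s :=
  fun a ha b hb _ => ((hs a).1 ha).2 b hb

theorem left_mem (hs : IsMaxChainIcc x y s) (hxy : x ≤ y) : x ∈ s :=
  hs.mem_of_forall ⟨le_rfl, hxy⟩ fun _ hb => .inl (hs.subset_Icc hb).1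

theorem right_mem (hs : IsMaxChainIcc x y s) (hxy : x ≤ y) : y ∈ s :=
  hs.mem_of_forall ⟨hxy, le_rfl⟩ fun _ hb => .inr (hs.subset_Icc hb).2

theorem inter_Iic (hs : IsMaxChainIcc x y s) (hz : z ∈ s) :
    IsMaxChainIcc x z (s ∩ Set.Iic z) := by
  refine fun a => ⟨fun ⟨ha, haz⟩ => ⟨⟨(hs.subset_Icc ha).1, haz⟩, fun b hb =>
    hs.isChain.total ha hb.1⟩, fun ⟨ha, hcomp⟩ => ⟨?_, ha.2⟩⟩
  refine hs.mem_of_forall ⟨ha.1, ha.2.trans (hs.subset_Icc hz).2⟩ fun b hb => ?_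
  rcases hs.isChain.total hb hz with hbz | hzb
  · exact hcomp b ⟨hb, hbz⟩
  · exact .inl (ha.2.trans hzb)

theorem inter_Ici (hs : IsMaxChainIcc x y s) (hz : z ∈ s) :
    IsMaxChainIcc z y (s ∩ Set.Ici z) := by
  refine fun a => ⟨fun ⟨ha, hza⟩ => ⟨⟨hza, (hs.subset_Icc ha).2⟩, fun b hb =>
    hs.isChain.total ha hb.1⟩, fun ⟨ha, hcomp⟩ => ⟨?_, ha.1⟩⟩
  refine hs.mem_of_forall ⟨(hs.subset_Icc hz).1.trans ha.1, ha.2⟩ fun b hb => ?_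
  rcases hs.isChain.total hb hz with hbz | hzb
  · exact .inr (hbz.trans ha.1)
  · exact hcomp b ⟨hb, hzb⟩

theorem union (hs : IsMaxChainIcc x z s) (ht : IsMaxChainIcc z y t)
    (hxz : x ≤ z) (hzy : z ≤ y) : IsMaxChainIcc x y (s ∪ t) := by
  have hsz : ∀ a ∈ s, x ≤ a ∧ a ≤ z := fun _ ha => hs.subset_Icc ha
  have hzt : ∀ a ∈ t, z ≤ a ∧ a ≤ y := fun _ ha => ht.subset_Icc ha
  refine fun a => ⟨?_, fun ⟨ha, hcomp⟩ => ?_⟩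
  · rintro (ha | ha)
    · refine ⟨⟨(hsz a ha).1, (hsz a ha).2.trans hzy⟩, ?_⟩
      rintro b (hb | hb)
      · exact hs.isChain.total ha hb
      · exact .inl ((hsz a ha).2.trans (hzt b hb).1)
    · refine ⟨⟨hxz.trans (hzt a ha).1, (hzt a ha).2⟩, ?_⟩
      rintro b (hb | hb)
      · exact .inr ((hsz b hb).2.trans (hzt a ha).1)
      · exact ht.isChain.total ha hb
  · rcases hcomp z (.inl (hs.right_mem hxz)) with haz | hza
    · exact .inl (hs.mem_of_forall ⟨ha.1, haz⟩ fun b hb => hcomp b (.inl hb))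
    · exact .inr (ht.mem_of_forall ⟨hza, ha.2⟩ fun b hb => hcomp b (.inr hb))

theorem union_inter_Iic (hs : IsMaxChainIcc x z s) (ht : IsMaxChainIcc z y t)
    (hxz : x ≤ z) : (s ∪ t) ∩ Set.Iic z = s := by
  ext a
  refine ⟨?_, fun ha => ⟨.inl ha, (hs.subset_Icc ha).2⟩⟩
  rintro ⟨ha | ha, haz⟩
  · exact ha
  · rw [le_antisymm haz (ht.subset_Icc ha).1]
    exact hs.right_mem hxz

theorem union_inter_Ici (hs : IsMaxChainIcc x z s) (ht : IsMaxChainIcc z y t)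
    (hzy : z ≤ y) : (s ∪ t) ∩ Set.Ici z = t := by
  ext a
  refine ⟨?_, fun ha => ⟨.inr ha, (ht.subset_Icc ha).1⟩⟩
  rintro ⟨ha | ha, hza⟩
  · rw [le_antisymm (hs.subset_Icc ha).2 hza]
    exact ht.left_mem hzy
  · exact ha

theorem exists_covBy [WellFoundedLT P] (hs : IsMaxChainIcc x y s) (hz : z ∈ s)
    (hzy : z < y) : ∃ v ∈ s, z ⋖ v := by
  have hy : y ∈ s := hs.right_mem ((hs.subset_Icc hz).1.trans hzy.le)
  obtain ⟨v, ⟨hv, hzv⟩, hmin⟩ :=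
    WellFounded.has_min (wellFounded_lt (α := P)) (s ∩ Set.Ioi z) ⟨y, hy, hzy⟩
  have hvle : ∀ b ∈ s, z < b → v ≤ b := fun b hb hzb =>
    hs.isChain.le_of_not_gt hb hv (hmin b ⟨hb, hzb⟩)
  refine ⟨v, hv, hzv, fun u hzu huv => hmin u ⟨?_, hzu⟩ huv⟩
  refine hs.mem_of_forall ⟨(hs.subset_Icc hz).1.trans hzu.le, huv.le.trans (hs.subset_Icc hv).2⟩
    fun b hb => ?_
  rcases hs.isChain.total hb hz with hbz | hzb
  · exact .inr (hbz.trans hzu.le)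
  · rcases hzb.eq_or_lt with rfl | hzb
    · exact .inr hzu.le
    · exact .inl (huv.le.trans (hvle b hb hzb))

end IsMaxChainIcc

theorem ncard_isMaxChainIcc_mem (hxz : x ≤ z) (hzy : z ≤ y) :
    {s | IsMaxChainIcc x y s ∧ z ∈ s}.ncard = numMaxChains x z * numMaxChains z y := by
  have himage : {s | IsMaxChainIcc x y s ∧ z ∈ s} =
      (fun p : Set P × Set P => p.1 ∪ p.2) ''
        ({s | IsMaxChainIcc x z s} ×ˢ {t | IsMaxChainIcc z y t}) := by
    ext u
    constructor
    · rintro ⟨hu, hz⟩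
      refine ⟨(u ∩ Set.Iic z, u ∩ Set.Ici z), ⟨hu.inter_Iic hz, hu.inter_Ici hz⟩, ?_⟩
      change u ∩ Set.Iic z ∪ u ∩ Set.Ici z = u
      rw [← Set.inter_union_distrib_left, Set.inter_eq_left]
      exact fun a ha => hu.isChain.total ha hz
    · rintro ⟨⟨s, t⟩, ⟨hs, ht⟩, rfl⟩
      exact ⟨hs.union ht hxz hzy, .inl (hs.right_mem hxz)⟩
  have hinj : Set.InjOn (fun p : Set P × Set P => p.1 ∪ p.2)
      ({s | IsMaxChainIcc x z s} ×ˢ {t | IsMaxChainIcc z y t}) := by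
    rintro ⟨s, t⟩ ⟨hs : IsMaxChainIcc x z s, ht : IsMaxChainIcc z y t⟩
      ⟨s', t'⟩ ⟨hs' : IsMaxChainIcc x z s', ht' : IsMaxChainIcc z y t'⟩ (h : s ∪ t = s' ∪ t')
    rw [Prod.mk.injEq]
    constructor
    · rw [← hs.union_inter_Iic ht hxz, h, hs'.union_inter_Iic ht' hxz]
    · rw [← hs.union_inter_Ici ht hzy, h, hs'.union_inter_Ici ht' hzy]
  rw [himage, hinj.ncard_image, Set.ncard_prod, numMaxChains_eq_ncard, numMaxChains_eq_ncard]

theorem numMaxChains_eq_one_of_wcovBy (h : x ⩿ y) : numMaxChains x y = 1 := by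
  rw [numMaxChains_eq_ncard, Set.ncard_eq_one]
  have hne : {s | IsMaxChainIcc x y s}.Nonempty := exists_isMaxChainIcc x y
  refine ⟨{x, y}, hne.subset_singleton_iff.1 fun s hs => ?_⟩
  refine Set.Subset.antisymm (h.Icc_eq ▸ hs.subset_Icc) ?_
  exact Set.pair_subset (hs.left_mem h.le) (hs.right_mem h.le)

end MaximalChains

section Levels

variable {P : Type*} [PartialOrder P] [OrderBot P] [GradeMinOrder ℕ P] {x y z : P} {i j n : ℕ}

theorem isNInterval_bot_left_iff : IsNInterval n ⊥ y ↔ grade ℕ y = n := by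
  simp [IsNInterval]

namespace IsNInterval

theorem trans (hxz : IsNInterval i x z) (hzy : IsNInterval j z y) : IsNInterval (i + j) x y :=
  ⟨hxz.1.trans hzy.1, by rw [hzy.2, hxz.2, add_assoc]⟩

theorem of_add_left (h : IsNInterval (i + j) x y) (hxz : IsNInterval i x z) (hzy : z ≤ y) :
    IsNInterval j z y :=
  ⟨hzy, by rw [h.2, hxz.2, add_assoc]⟩

theorem lt (h : IsNInterval n x y) (hn : n ≠ 0) : x < y :=
  h.1.lt_of_ne fun hxy => by have := h.2; rw [hxy] at this; omega

end IsNInterval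

theorem isNInterval_zero_iff : IsNInterval 0 x y ↔ x = y := by
  refine ⟨fun h => ?_, fun h => h ▸ ⟨le_rfl, rfl⟩⟩
  by_contra hne
  exact (grade_strictMono (𝕆 := ℕ) (h.1.lt_of_ne hne)).ne' h.2

theorem isNInterval_one_iff : IsNInterval 1 x y ↔ x ⋖ y := by
  rw [covBy_iff_lt_covBy_grade (𝕆 := ℕ), Nat.covBy_iff_add_one_eq]
  exact ⟨fun h => ⟨h.lt one_ne_zero, h.2.symm⟩, fun h => ⟨h.1.le, h.2.symm⟩⟩

namespace IsNInterval

theorem exists_mem_of_isMaxChainIcc {s : Set P} (h : IsNInterval (i + j) x y)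
    (hs : IsMaxChainIcc x y s) : ∃ z ∈ s, IsNInterval i x z ∧ IsNInterval j z y := by
  induction i generalizing j with
  | zero =>
    exact ⟨x, hs.left_mem h.1, isNInterval_zero_iff.2 rfl, by rwa [zero_add] at h⟩
  | succ i ih =>
    obtain ⟨z, hzs, hxz, hzy⟩ := ih (j := j + 1) (by rwa [add_right_comm] at h)
    obtain ⟨v, hvs, hzv⟩ := hs.exists_covBy hzs (hzy.lt j.succ_ne_zero)
    have hxv : IsNInterval (i + 1) x v := hxz.trans (isNInterval_one_iff.2 hzv)
    exact ⟨v, hvs, hxv, h.of_add_left hxv (hs.subset_Icc hvs).2⟩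

theorem exists_between (h : IsNInterval (i + j) x y) :
    ∃ z, IsNInterval i x z ∧ IsNInterval j z y := by
  obtain ⟨s, hs⟩ := exists_isMaxChainIcc x y
  obtain ⟨z, -, hz⟩ := h.exists_mem_of_isMaxChainIcc hs
  exact ⟨z, hz⟩

end IsNInterval

theorem IsMaxChainIcc.eq_of_grade_eq {s : Set P} {z' : P} (hs : IsMaxChainIcc x y s) (hz : z ∈ s)
    (hz' : z' ∈ s) (h : grade ℕ z = grade ℕ z') : z = z' := by
  rcases hs.isChain.total hz hz' with hle | hle
  · exact isNInterval_zero_iff.1 ⟨hle, h.symm⟩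
  · exact (isNInterval_zero_iff.1 ⟨hle, h⟩).symm

variable [Finite P]

/-- The elements of `[x, y]` whose rank in `[x, y]`, that is, relative to `x`, is `i`. -/
noncomputable def level (x y : P) (i : ℕ) : Finset P :=
  (Set.toFinite {z | IsNInterval i x z ∧ z ≤ y}).toFinset

theorem mem_level : z ∈ level x y i ↔ IsNInterval i x z ∧ z ≤ y :=
  Set.Finite.mem_toFinset _

theorem IsNInterval.mem_level_iff (h : IsNInterval (i + j) x y) :
    z ∈ level x y i ↔ IsNInterval i x z ∧ IsNInterval j z y :=
  mem_level.trans ⟨fun hz => ⟨hz.1, h.of_add_left hz.1 hz.2⟩, fun hz => ⟨hz.1, hz.2.1⟩⟩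

theorem level_zero (hxy : x ≤ y) : level x y 0 = {x} := by
  ext z
  rw [mem_level, isNInterval_zero_iff, Finset.mem_singleton]
  exact ⟨fun hz => hz.1.symm, by rintro rfl; exact ⟨rfl, hxy⟩⟩

theorem IsNInterval.level_self (h : IsNInterval n x y) : level x y n = {y} := by
  ext z
  rw [IsNInterval.mem_level_iff (j := 0) h, isNInterval_zero_iff, Finset.mem_singleton]
  exact ⟨fun hz => hz.2, by rintro rfl; exact ⟨h, rfl⟩⟩

theorem level_subset_level_right {y' : P} (hy : y ≤ y') (x : P) (i : ℕ) :
    level x y i ⊆ level x y' i :=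
  fun _ hz => mem_level.2 ⟨(mem_level.1 hz).1, (mem_level.1 hz).2.trans hy⟩

theorem IsNInterval.level_subset_level_left (h : IsNInterval i x z) (y : P) (j : ℕ) :
    level z y j ⊆ level x y (i + j) :=
  fun _ hw => mem_level.2 ⟨h.trans (mem_level.1 hw).1, (mem_level.1 hw).2⟩

open Finset in
theorem IsNInterval.numMaxChains_eq_sum (h : IsNInterval (i + j) x y) :
    numMaxChains x y = ∑ z ∈ level x y i, numMaxChains x z * numMaxChains z y := by
  classical
  set C : Finset (Set P) := {s | IsMaxChainIcc x y s}.toFinite.toFinset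
  have hC : ∀ s, s ∈ C ↔ IsMaxChainIcc x y s := fun s => Set.Finite.mem_toFinset _
  calc numMaxChains x y = ∑ s ∈ C, 1 := by
        rw [numMaxChains_eq_ncard, Set.ncard_eq_toFinset_card, card_eq_sum_ones]
    _ = ∑ s ∈ C, #{z ∈ level x y i | z ∈ s} := by
        refine sum_congr rfl fun s hs => (card_eq_one.2 ?_).symm
        obtain ⟨z, hzs, hz⟩ := h.exists_mem_of_isMaxChainIcc ((hC s).1 hs)
        refine ⟨z, eq_singleton_iff_unique_mem.2
          ⟨mem_filter.2 ⟨h.mem_level_iff.2 hz, hzs⟩, fun z' hz' => ?_⟩⟩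
        obtain ⟨hz', hzs'⟩ := mem_filter.1 hz'
        exact ((hC s).1 hs).eq_of_grade_eq hzs' hzs
          ((mem_level.1 hz').1.2.trans hz.1.2.symm)
    _ = ∑ z ∈ level x y i, #{s ∈ C | z ∈ s} :=
        sum_card_bipartiteAbove_eq_sum_card_bipartiteBelow fun (s : Set P) (z : P) => z ∈ s
    _ = ∑ z ∈ level x y i, numMaxChains x z * numMaxChains z y := by
        refine sum_congr rfl fun z hz => ?_
        obtain ⟨hxz, hzy⟩ := mem_level.1 hz
        rw [← ncard_isMaxChainIcc_mem hxz.1 hzy, ← Set.ncard_coe_finset, coe_filter]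
        simp only [hC]

theorem IsNInterval.card_level_mul {a b : ℕ} (h : IsNInterval (i + j) x y)
    (ha : ∀ z, IsNInterval i x z → numMaxChains x z = a)
    (hb : ∀ z, IsNInterval i x z → IsNInterval j z y → numMaxChains z y = b) :
    (level x y i).card * (a * b) = numMaxChains x y := by
  rw [h.numMaxChains_eq_sum, Finset.sum_const_nat fun z hz => ?_]
  obtain ⟨hxz, hzy⟩ := h.mem_level_iff.1 hz
  rw [ha z hxz, hb z hxz hzy]

open Finset in
theorem IsNInterval.sum_comp_grade {M : Type*} [AddCommMonoid M] (h : IsNInterval n x y)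
    (f : ℕ → M) :
    ∑ z ∈ (Set.toFinite (Set.Icc x y)).toFinset, f (grade ℕ z) =
      ∑ k ∈ range (n + 1), #(level x y k) • f (grade ℕ x + k) := by
  classical
  have hmem : ∀ z, z ∈ (Set.toFinite (Set.Icc x y)).toFinset ↔ x ≤ z ∧ z ≤ y := fun z =>
    Set.Finite.mem_toFinset _
  have hgrade : ∀ z ∈ (Set.toFinite (Set.Icc x y)).toFinset,
      grade ℕ x ≤ grade ℕ z ∧ grade ℕ z ≤ grade ℕ x + n := fun z hz =>
    ⟨grade_mono ((hmem z).1 hz).1, h.2 ▸ grade_mono ((hmem z).1 hz).2⟩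
  rw [← sum_fiberwise_of_maps_to (g := fun z => grade ℕ z - grade ℕ x) (t := range (n + 1))
    fun z hz => mem_range.2 (by have := hgrade z hz; omega)]
  refine sum_congr rfl fun k _ => ?_
  have hfiber : {z ∈ (Set.toFinite (Set.Icc x y)).toFinset | grade ℕ z - grade ℕ x = k} =
      level x y k := by
    ext z
    rw [mem_filter, mem_level]
    refine ⟨fun ⟨hz, _⟩ => ⟨⟨((hmem z).1 hz).1, ?_⟩, ((hmem z).1 hz).2⟩,
      fun ⟨hz, hzy⟩ => ⟨(hmem z).2 ⟨hz.1, hzy⟩, by rw [hz.2]; omega⟩⟩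
    have := (hgrade z hz).1
    omega
  rw [hfiber, sum_congr rfl fun z hz => by rw [(mem_level.1 hz).1.2], sum_const]

end Levels

section Eulerian

open Finset

variable {P : Type*} [PartialOrder P] [BoundedOrder P] [Finite P] [GradeMinOrder ℕ P]
  {x y : P} {n : ℕ}

namespace IsEulerianPoset

theorem sum_neg_one_pow_grade (hP : IsEulerianPoset P) (hxy : x < y) :
    ∑ z ∈ (Set.toFinite (Set.Icc x y)).toFinset, (-1 : ℤ) ^ grade ℕ z = 0 := by
  classical
  set I := (Set.toFinite (Set.Icc x y)).toFinset
  have hcard : #{z ∈ I | Even (grade ℕ z)} = #{z ∈ I | ¬ Even (grade ℕ z)} := by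
    rw [← Set.ncard_coe_finset, ← Set.ncard_coe_finset]
    convert hP x y hxy using 2 <;> ext z <;> simp [I]
  rw [← sum_filter_add_sum_filter_not I fun z => Even (grade ℕ z),
    sum_congr rfl fun z hz => (mem_filter.1 hz).2.neg_one_pow,
    sum_congr (s₁ := {z ∈ I | ¬ Even (grade ℕ z)}) rfl fun z hz =>
      (Nat.not_even_iff_odd.1 (mem_filter.1 hz).2).neg_one_pow,
    sum_const, sum_const, hcard]
  simp only [smul_neg, add_neg_cancel]

theorem sum_neg_one_pow_mul_card_level (hP : IsEulerianPoset P) (h : IsNInterval n x y)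
    (hn : n ≠ 0) : ∑ k ∈ range (n + 1), (-1 : ℤ) ^ k * #(level x y k) = 0 := by
  have hsum := hP.sum_neg_one_pow_grade (h.lt hn)
  rw [h.sum_comp_grade (fun k => (-1 : ℤ) ^ k)] at hsum
  refine (mul_eq_zero.1 (?_ : (-1 : ℤ) ^ grade ℕ x * _ = 0)).resolve_left (by simp)
  rw [← hsum, mul_sum]
  exact sum_congr rfl fun k _ => by rw [nsmul_eq_mul, pow_add]; ring

theorem card_atoms_eq_two (hP : IsEulerianPoset P) (h : IsNInterval 2 x y) :
    #(level x y 1) = 2 := by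
  have hsum := hP.sum_neg_one_pow_mul_card_level h two_ne_zero
  simp only [sum_range_succ, range_zero, sum_empty, level_zero h.1, h.level_self,
    card_singleton] at hsum
  omega

theorem euler_relation_four (hP : IsEulerianPoset P) (h : IsNInterval 4 x y) :
    #(level x y 1) + #(level x y 3) = #(level x y 2) + 2 := by
  have hsum := hP.sum_neg_one_pow_mul_card_level h four_ne_zero
  simp only [sum_range_succ, range_zero, sum_empty, level_zero h.1, h.level_self,
    card_singleton] at hsum
  omega

theorem euler_relation_six (hP : IsEulerianPoset P) (h : IsNInterval 6 x y) :
    #(level x y 1) + #(level x y 3) + #(level x y 5) = #(level x y 2) + #(level x y 4) + 2 := by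
  have hsum := hP.sum_neg_one_pow_mul_card_level h (by norm_num)
  simp only [sum_range_succ, range_zero, sum_empty, level_zero h.1, h.level_self,
    card_singleton] at hsum
  omega

theorem numMaxChains_eq_two (hP : IsEulerianPoset P) (h : IsNInterval 2 x y) :
    numMaxChains x y = 2 := by
  have hone : ∀ u v : P, IsNInterval 1 u v → numMaxChains u v = 1 := fun u v huv =>
    numMaxChains_eq_one_of_wcovBy (isNInterval_one_iff.1 huv).wcovBy
  rw [← IsNInterval.card_level_mul (i := 1) (j := 1) h (hone x) fun z _ => hone z y,
    hP.card_atoms_eq_two h]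

end IsEulerianPoset

end Eulerian

section Sheffer

open Finset
open scoped Nat

variable {P : Type*} [PartialOrder P] [BoundedOrder P] [Finite P] [GradeMinOrder ℕ P]
  {B D : ℕ → ℕ} {x y z : P} {i j n : ℕ}

namespace IsShefferPoset

theorem card_level_mul (hS : IsShefferPoset P B D) (hx : x ≠ ⊥) (h : IsNInterval (i + j) x y) :
    #(level x y i) * (B i * B j) = B (i + j) := by
  rw [← hS.binomial _ x y hx h]
  exact h.card_level_mul (fun z hz => hS.binomial i x z hx hz) fun z hxz hzy =>
    hS.binomial j z y (ne_bot_of_le_ne_bot hx hxz.1) hzy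

theorem card_level_bot_mul (hS : IsShefferPoset P B D) (hi : i ≠ 0)
    (h : IsNInterval (i + j) ⊥ y) : #(level ⊥ y i) * (D i * B j) = D (i + j) := by
  rw [← hS.sheffer _ y h]
  exact h.card_level_mul (hS.sheffer i) fun z hz => hS.binomial j z y (hz.lt hi).ne'

theorem sheffer_one (hS : IsShefferPoset P B D) (h : IsNInterval 1 ⊥ y) : D 1 = 1 := by
  rw [← hS.sheffer 1 y h, numMaxChains_eq_one_of_wcovBy (isNInterval_one_iff.1 h).wcovBy]

theorem sheffer_two (hS : IsShefferPoset P B D) (hP : IsEulerianPoset P)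
    (h : IsNInterval 2 ⊥ y) : D 2 = 2 := by
  rw [← hS.sheffer 2 y h, hP.numMaxChains_eq_two h]

theorem binomial_eq_factorial (hS : IsShefferPoset P B D) (hP : IsEulerianPoset P)
    (hB : B 3 = 6) (hx : x ≠ ⊥) (h : IsNInterval 4 x y) : ∀ k ≤ 4, B k = k ! := by
  have hB0 : B 0 = 1 := by
    rw [← hS.binomial 0 x x hx (isNInterval_zero_iff.2 rfl),
      numMaxChains_eq_one_of_wcovBy (WCovBy.refl x)]
  have hB1 : B 1 = 1 := by
    obtain ⟨z, hz, -⟩ := IsNInterval.exists_between (i := 1) (j := 3) h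
    rw [← hS.binomial 1 x z hx hz, numMaxChains_eq_one_of_wcovBy (isNInterval_one_iff.1 hz).wcovBy]
  have hB2 : B 2 = 2 := by
    obtain ⟨z, hz, -⟩ := IsNInterval.exists_between (i := 2) (j := 2) h
    rw [← hS.binomial 2 x z hx hz, hP.numMaxChains_eq_two hz]
  have hB4 : B 4 = 24 := by
    have hf₁ := hS.card_level_mul (i := 1) (j := 3) hx h
    have hf₂ := hS.card_level_mul (i := 2) (j := 2) hx h
    have hf₃ := hS.card_level_mul (i := 3) (j := 1) hx h
    have hEuler := hP.euler_relation_four h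
    simp only [hB, hB1, hB2, Nat.reduceAdd] at hf₁ hf₂ hf₃
    omega
  intro k hk
  interval_cases k <;> assumption

theorem card_level_eq_choose (hS : IsShefferPoset P B D) (hB : ∀ k ≤ i + j, B k = k !)
    (hx : x ≠ ⊥) (h : IsNInterval (i + j) x y) : #(level x y i) = (i + j).choose i := by
  have hmul := hS.card_level_mul hx h
  rw [hB i (Nat.le_add_right i j), hB j (Nat.le_add_left j i), hB _ le_rfl,
    ← Nat.add_choose_mul_factorial_mul_factorial, ← Nat.choose_symm_add, mul_assoc] at hmul
  exact Nat.eq_of_mul_eq_mul_right (Nat.mul_pos i.factorial_pos j.factorial_pos) hmul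

theorem card_atoms (hS : IsShefferPoset P B D) (hB : ∀ k ≤ n + 1, B k = k !) (hx : x ≠ ⊥)
    (h : IsNInterval (n + 1) x y) : #(level x y 1) = n + 1 := by
  rw [add_comm] at h hB ⊢
  rw [hS.card_level_eq_choose hB hx h, Nat.choose_one_right]

theorem card_coatoms (hS : IsShefferPoset P B D) (hB : ∀ k ≤ n + 1, B k = k !) (hx : x ≠ ⊥)
    (h : IsNInterval (n + 1) x y) : #(level x y n) = n + 1 := by
  rw [hS.card_level_eq_choose hB hx h, Nat.choose_succ_self_right]

theorem le_card_coatoms (hS : IsShefferPoset P B D) (hB : ∀ k ≤ n + 1, B k = k !)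
    (hz : z ≠ ⊥) (hxz : IsNInterval i x z) (hzy : IsNInterval (n + 1) z y) :
    n + 1 ≤ #(level x y (i + n)) := by
  rw [← hS.card_coatoms hB hz hzy]
  exact card_le_card (hxz.level_subset_level_left y n)

theorem exists_common_coatom (hS : IsShefferPoset P B D) (hB : ∀ k ≤ n + 1, B k = k !)
    (hx : x ≠ ⊥) (h : IsNInterval (n + 2) x y) (hcard : #(level x y 1) < 2 * (n + 1))
    {a a' : P} (ha : a ∈ level x y 1) (ha' : a' ∈ level x y 1) :
    ∃ u ∈ level x y (n + 1), a ≤ u ∧ a' ≤ u := by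
  classical
  rw [show n + 2 = 1 + (n + 1) by omega] at h
  have hcoatoms : #(level x y (n + 1)) = #(level x y 1) := by
    refine Nat.eq_of_mul_eq_mul_right (?_ : 0 < B 1 * B (n + 1)) ?_
    · rw [hB 1 (by omega), hB (n + 1) le_rfl]
      positivity
    · rw [hS.card_level_mul hx h, mul_comm (B 1), hS.card_level_mul hx (add_comm 1 _ ▸ h),
        add_comm]
  have habove : ∀ b ∈ level x y 1,
      level b y n ⊆ level x y (n + 1) ∧ #(level b y n) = n + 1 := fun b hb => by
    obtain ⟨hxb, hby⟩ := h.mem_level_iff.1 hb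
    refine ⟨?_, hS.card_coatoms hB (ne_bot_of_le_ne_bot hx hxb.1) hby⟩
    rw [add_comm]
    exact hxb.level_subset_level_left y n
  obtain ⟨u, hu⟩ := inter_nonempty_of_card_lt_card_add_card (habove a ha).1 (habove a' ha').1
    (by rw [hcoatoms, (habove a ha).2, (habove a' ha').2]; omega)
  rw [mem_inter] at hu
  exact ⟨u, (habove a ha).1 hu.1, (mem_level.1 hu.1).1.1, (mem_level.1 hu.2).1.1⟩

theorem exists_level_two_upper_bound (hS : IsShefferPoset P B D) (hB : ∀ k ≤ n, B k = k !)
    (hn : 2 ≤ n) (hx : x ≠ ⊥) (h : IsNInterval n x y) {a a' : P} (ha : a ∈ level x y 1)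
    (ha' : a' ∈ level x y 1) : ∃ w ∈ level x y 2, a ≤ w ∧ a' ≤ w := by
  induction n, hn using Nat.le_induction generalizing y with
  | base =>
    exact ⟨y, h.level_self ▸ mem_singleton_self y, (mem_level.1 ha).2, (mem_level.1 ha').2⟩
  | succ n hn ih =>
    obtain ⟨m, rfl⟩ : ∃ m, n = m + 1 := ⟨n - 1, by omega⟩
    have hcard := hS.card_atoms hB hx h
    obtain ⟨u, hu, hau, hau'⟩ := hS.exists_common_coatom (fun k hk => hB k (by omega)) hx h
      (by omega) ha ha'
    obtain ⟨hxu, huy⟩ := mem_level.1 hu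
    obtain ⟨w, hw, haw⟩ := ih (fun k hk => hB k (by omega)) hxu
      (mem_level.2 ⟨(mem_level.1 ha).1, hau⟩) (mem_level.2 ⟨(mem_level.1 ha').1, hau'⟩)
    exact ⟨w, level_subset_level_right huy x 2 hw, haw⟩

theorem card_atoms_le (hS : IsShefferPoset P B D) (hB : ∀ k ≤ n + 2, B k = k !) (hx : x ≠ ⊥)
    (h : IsNInterval (n + 3) x y) (hcard : #(level x y 1) < 2 * (n + 2)) :
    #(level x y 1) ≤ n + 3 := by
  classical
  obtain hempty | ⟨a, ha⟩ := (level x y 1).eq_empty_or_nonempty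
  · simp [hempty]
  obtain ⟨hxa, hay⟩ := (show IsNInterval (1 + (n + 2)) x y by rwa [add_comm]).mem_level_iff.1 ha
  have hcover : level x y 1 ⊆ insert a ((level a y 1).biUnion fun w => (level x w 1).erase a) := by
    intro a' ha'
    obtain ⟨u, hu, hau, hau'⟩ := hS.exists_common_coatom hB hx h hcard ha ha'
    obtain ⟨hxu, huy⟩ := mem_level.1 hu
    obtain ⟨w, hw, haw, haw'⟩ := hS.exists_level_two_upper_bound hB (by omega) hx hxu
      (mem_level.2 ⟨hxa, hau⟩) (mem_level.2 ⟨(mem_level.1 ha').1, hau'⟩)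
    obtain ⟨hxw, hwu⟩ := mem_level.1 hw
    have haw₁ : IsNInterval 1 a w := IsNInterval.of_add_left (i := 1) hxw hxa haw
    rw [mem_insert, mem_biUnion]
    refine or_iff_not_imp_left.2 fun hne => ⟨w, mem_level.2 ⟨haw₁, hwu.trans huy⟩, ?_⟩
    exact mem_erase.2 ⟨hne, mem_level.2 ⟨(mem_level.1 ha').1, haw'⟩⟩
  have hdiamond : ∀ w ∈ level a y 1, #((level x w 1).erase a) ≤ 1 := fun w hw => by
    have haw := (mem_level.1 hw).1
    rw [card_erase_of_mem (mem_level.2 ⟨hxa, haw.1⟩),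
      hS.card_atoms (n := 1) (fun k hk => hB k (by omega)) hx (hxa.trans haw)]
  calc #(level x y 1)
    _ ≤ #((level a y 1).biUnion fun w => (level x w 1).erase a) + 1 :=
        (card_le_card hcover).trans (card_insert_le _ _)
    _ ≤ #(level a y 1) * 1 + 1 := by gcongr; exact card_biUnion_le_card_mul _ _ _ hdiamond
    _ = n + 3 := by rw [hS.card_atoms hB (ne_bot_of_le_ne_bot hx hxa.1) hay, mul_one]

theorem sheffer_three_cases (hS : IsShefferPoset P B D) (hP : IsEulerianPoset P)
    (hB : ∀ k ≤ 3, B k = k !) (h : IsNInterval 4 ⊥ y) :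
    (D 3 = 4 ∨ D 3 = 6 ∨ D 3 = 8) ∨ D 3 = 10 ∧ D 4 = 120 := by
  have hB1 : B 1 = 1 := hB 1 (by norm_num)
  have hB2 : B 2 = 2 := hB 2 (by norm_num)
  have hB3 : B 3 = 6 := hB 3 le_rfl
  obtain ⟨a, ha, hay⟩ := IsNInterval.exists_between (i := 1) (j := 3) h
  obtain ⟨w, hw, -⟩ := IsNInterval.exists_between (i := 2) (j := 2) h
  obtain ⟨v, hv, -⟩ := IsNInterval.exists_between (i := 3) (j := 1) h
  have hD1 := hS.sheffer_one ha
  have hD2 := hS.sheffer_two hP hw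
  have hf₁_pos : 0 < #(level ⊥ y 1) := card_pos.2 ⟨a, mem_level.2 ⟨ha, hay.1⟩⟩
  have hf₁ := hS.card_level_bot_mul (i := 1) (j := 3) one_ne_zero h
  have hf₂ := hS.card_level_bot_mul (i := 2) (j := 2) two_ne_zero h
  have hf₃ := hS.card_level_bot_mul (i := 3) (j := 1) three_ne_zero h
  have hEuler := hP.euler_relation_four h
  have hD3 := hS.card_level_bot_mul (i := 2) (j := 1) two_ne_zero hv
  simp only [hB1, hB2, hB3, hD1, hD2, Nat.reduceAdd, Nat.reduceMul, mul_one] at hf₁ hf₂ hf₃ hD3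
  generalize #(level ⊥ v 2) = q at hD3
  have hq : (#(level ⊥ y 1) + 4) * q = 6 * #(level ⊥ y 1) :=
    calc (#(level ⊥ y 1) + 4) * q
      _ = 2 * #(level ⊥ y 3) * q := by congr 1; omega
      _ = #(level ⊥ y 3) * D 3 := by rw [← hD3]; ring
      _ = 6 * #(level ⊥ y 1) := by omega
  have hq_lt : q < 6 := by
    by_contra! hq_ge
    nlinarith
  interval_cases q <;> omega

theorem not_dodecahedral (hS : IsShefferPoset P B D) (hP : IsEulerianPoset P)
    (hB : ∀ k ≤ 4, B k = k !) (h : IsNInterval 6 ⊥ y) : ¬ (D 3 = 10 ∧ D 4 = 120) := by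
  rintro ⟨hD3, hD4⟩
  have hB1 : B 1 = 1 := hB 1 (by norm_num)
  have hB2 : B 2 = 2 := hB 2 (by norm_num)
  have hB3 : B 3 = 6 := hB 3 (by norm_num)
  have hB4 : B 4 = 24 := hB 4 le_rfl
  obtain ⟨a, ha, hay⟩ := IsNInterval.exists_between (i := 1) (j := 5) h
  obtain ⟨w, hw, hwy⟩ := IsNInterval.exists_between (i := 2) (j := 4) h
  obtain ⟨u, hu, -⟩ := IsNInterval.exists_between (i := 5) (j := 1) h
  obtain ⟨b, hb, hbu⟩ := IsNInterval.exists_between (i := 1) (j := 4) hu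
  have hD1 := hS.sheffer_one ha
  have hD2 := hS.sheffer_two hP hw
  have hB5 := hS.card_level_mul (i := 1) (j := 4) (ha.lt one_ne_zero).ne' hay
  have hD5 := hS.card_level_bot_mul (i := 4) (j := 1) four_ne_zero hu
  have hf₁ := hS.card_level_bot_mul (i := 1) (j := 5) one_ne_zero h
  have hf₂ := hS.card_level_bot_mul (i := 2) (j := 4) two_ne_zero h
  have hf₃ := hS.card_level_bot_mul (i := 3) (j := 3) three_ne_zero h
  have hf₄ := hS.card_level_bot_mul (i := 4) (j := 2) four_ne_zero h
  have hf₅ := hS.card_level_bot_mul (i := 5) (j := 1) (by norm_num) h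
  have hEuler := hP.euler_relation_six h
  simp only [hB1, hB2, hB3, hB4, hD1, hD2, hD3, hD4, Nat.reduceAdd, Nat.reduceMul,
    one_mul, mul_one] at hB5 hD5 hf₁ hf₂ hf₃ hf₄ hf₅
  have hf₅_ge : 4 ≤ #(level ⊥ y 5) := hS.le_card_coatoms hB (hw.lt two_ne_zero).ne' hw hwy
  have hm : 4 ≤ #(level ⊥ u 4) := hS.le_card_coatoms hB (hb.lt one_ne_zero).ne' hb hbu
  have hc := hS.card_atoms_le hB (ha.lt one_ne_zero).ne' hay
  rw [← hB5] at hf₁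
  rw [← hD5] at hf₅
  have hf₁_mul : #(level ⊥ y 1) * #(level a y 1) = 10 * #(level ⊥ y 4) := by linarith
  have hf₅_mul : #(level ⊥ y 5) * #(level ⊥ u 4) = 2 * #(level ⊥ y 4) := by linarith
  have hf₁_add : #(level ⊥ y 1) + #(level ⊥ y 5) = 2 * #(level ⊥ y 4) + 2 := by omega
  rcases lt_or_ge #(level a y 1) 8 with hlt | hge
  · have := Nat.mul_le_mul_left #(level ⊥ y 1) (hc hlt)
    omega
  · have := Nat.mul_le_mul_left #(level ⊥ y 1) hge
    have := Nat.mul_le_mul_left #(level ⊥ y 5) hm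
    omega

end IsShefferPoset

end Sheffer

theorem lemmad {P : Type*} [PartialOrder P] [BoundedOrder P] [Finite P] [GradeMinOrder ℕ P]
    (n : ℕ) (hn : 6 ≤ n) (hrank : grade ℕ (⊤ : P) = n)
    (B D : ℕ → ℕ) (hSheffer : IsShefferPoset P B D) (hEulerian : IsEulerianPoset P)
    (hB : B 3 = 6) :
    D 3 = 4 ∨ D 3 = 6 ∨ D 3 = 8 := by
  obtain ⟨t, ht, -⟩ := IsNInterval.exists_between (i := 6) (j := n - 6)
    (show IsNInterval _ (⊥ : P) ⊤ from isNInterval_bot_left_iff.2 (by omega))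
  obtain ⟨a, ha, hat⟩ := IsNInterval.exists_between (i := 1) (j := 5) ht
  obtain ⟨v, hav, -⟩ := IsNInterval.exists_between (i := 4) (j := 1) hat
  obtain ⟨w, hw, -⟩ := IsNInterval.exists_between (i := 4) (j := 2) ht
  have hfactorial := hSheffer.binomial_eq_factorial hEulerian hB (ha.lt one_ne_zero).ne' hav
  have hcases := hSheffer.sheffer_three_cases hEulerian (fun k hk => hfactorial k (by omega)) hw
  exact hcases.resolve_right (hSheffer.not_dodecahedral hEulerian hfactorial ht)
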